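/- Let $m,n,q\ge 1$, $A,B\in\mathbb{R}^{m\times n}$, $b\in\mathbb{R}^m$, let $|x|$ denote the entrywise absolute value of $x\in\mathbb{R}^n$, and assume that the solution set $$\mathcal{X}^*=\{x\in\mathbb{R}^n : Ax-B|x|=b\}$$ is nonempty. Let $S\in\mathbb{R}^{m\times q}$ be a random matrix on a probability space such that $\mathbb{E}[SS^\top]$ exists and is positive definite. With the convention $0/0=0$, assume that the quotient $SS^\top/\|S^\top A\|_2^2$ is well defined and has a (finite) expectation, i.e. almost surely $S^\top A=0$ implies $S=0$, and the entries of $SS^\top/\|S^\top A\|_2^2$ are integrable; put $$H=\mathbb{E}\left[\frac{SS^\top}{\|S^\top A\|_2^2}\right].$$ Let $S_0,S_1,\ldots$ be independent random matrices with the same distribution as $S$, let $x^0\in\mathbb{R}^n$ be deterministic, and for $\alpha>0$ let $$x^{k+1}=x^k-\alpha\,\frac{A^\top S_kS_k^\top(Ax^k-B|x^k|-b)}{\|S_k^\top A\|_2^2},\qquad k\ge 0 .$$ Here $\|\cdot\|_2$ is the Euclidean norm of a vector and the spectral norm of a matrix. Write $\sigma=\sigma_n(H^{1/2}A)$, where $\sigma_n(M)=\sqrt{\lambda_{\min}(M^\top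 M)}$ for a matrix $M$ with $n$ columns, $\beta=\|H^{1/2}B\|_2$, $\lambda=\lambda_{\min}(H)$, and $\operatorname{dist}_{\mathcal{X}^*}(x)=\inf_{y\in\mathcal{X}^*}\|x-y\|_2$. (i) If $\sigma=\beta$ and $\alpha\in(0,1)$, then there are indices $k_1<k_2<\cdots$ such that almost surely $x^{k_j}$ converges, as $j\to\infty$, to a (possibly random) point of $\mathcal{X}^*$, and almost surely $Ax^k-B|x^k|-b\to 0$ as $k\to\infty$. (ii) If $\sigma>\beta$, $\xi\in\left[\frac{\sigma+\beta}{\sigma},2\right)$ and $\alpha=(2-\xi)\frac{\sigma}{\sigma-\beta}$, then for every $x^*\in\mathcal{X}^*$, $x^*$ is the unique element of $\mathcal{X}^*$ and, for all $k\ge 0$, $$\mathbb{E}\left[\|x^k-x^*\|_2^2\right]\le\left(1-(2-\xi)\xi\sigma^2\right)^k\|x^0-x^*\|_2^2<\infty .$$ (iii) Suppose that zero is the unique solution of $Ax-B|x|=0$, that $\kappa>0$ satisfies $\kappa\operatorname{dist}_{\mathcal{X}^*}(x)\le\|Ax-B|x|-b\|_2$ for all $x\in\mathbb{R}^n$, and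 that $\sigma^2>\beta^2-\lambda\kappa^2$. Put $T=\sigma^2-\beta^2+\lambda\kappa^2$. If $\xi\in\left[\frac{2(\sigma^2-\beta^2)}{T},2\right)$ and $\alpha=(2-\xi)\frac{T}{2\lambda\kappa^2}$, then for all $k\ge 0$ $$\mathbb{E}\left[\operatorname{dist}^2_{\mathcal{X}^*}(x^k)\right]\le\left(1-(2-\xi)\xi\,\frac{T^2}{4\lambda\kappa^2}\right)^k\operatorname{dist}^2_{\mathcal{X}^*}(x^0)<\infty .$$ -/

import Mathlib

open MeasureTheory ProbabilityTheory Filter Topology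
open scoped Matrix

namespace GAVE

/-- The Borel (product) sigma-algebra on real matrices. -/
instance matrixMeasurableSpace (m q : ℕ) : MeasurableSpace (Matrix (Fin m) (Fin q) ℝ) :=
  (inferInstance : MeasurableSpace (Fin m → Fin q → ℝ))

section Norm

open scoped Matrix.Norms.L2Operator

/-- The spectral norm `‖M‖₂`, i.e. the operator norm induced by the Euclidean norms. -/
noncomputable def specNorm {m n : ℕ} (M : Matrix (Fin m) (Fin n) ℝ) : ℝ := ‖M‖

end Norm

/-- The smallest singular value `σ_n(M)` of an `m × n` matrix, the `n`-th of the `n` values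
`√(λ_i(Mᵀ M))` in decreasing order. Mathlib indexes singular values from `0`. -/
noncomputable def sigmaN {m n : ℕ} (M : Matrix (Fin m) (Fin n) ℝ) : ℝ :=
  (Matrix.toEuclideanLin M).singularValues (n - 1)

/-- The smallest eigenvalue of a symmetric matrix. -/
noncomputable def lambdaMin {m : ℕ} (M : Matrix (Fin m) (Fin m) ℝ) : ℝ :=
  sInf (spectrum ℝ M)

/-- The square root `M^{1/2} = U Λ^{1/2} Uᵀ` of a positive semidefinite matrix `M = U Λ Uᵀ`. -/
noncomputable def psdSqrt {m : ℕ} (M : Matrix (Fin m) (Fin m) ℝ) : Matrix (Fin m) (Fin m) ℝ :=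
  cfc Real.sqrt M

/-- The entrywise absolute value `|x|`. -/
noncomputable def absVec {n : ℕ} (x : EuclideanSpace ℝ (Fin n)) : EuclideanSpace ℝ (Fin n) :=
  WithLp.toLp 2 fun i => |x i|

/-- The residual `A x - B |x| - b`. -/
noncomputable def residual {m n : ℕ} (A B : Matrix (Fin m) (Fin n) ℝ)
    (b : EuclideanSpace ℝ (Fin m)) (x : EuclideanSpace ℝ (Fin n)) : EuclideanSpace ℝ (Fin m) :=
  Matrix.toEuclideanLin A x - Matrix.toEuclideanLin B (absVec x) - b

/-- The solution set of `A x - B |x| = b`. -/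
def solutionSet {m n : ℕ} (A B : Matrix (Fin m) (Fin n) ℝ)
    (b : EuclideanSpace ℝ (Fin m)) : Set (EuclideanSpace ℝ (Fin n)) :=
  {x | Matrix.toEuclideanLin A x - Matrix.toEuclideanLin B (absVec x) = b}

/-- The matrix `E[S Sᵀ]`. -/
noncomputable def secondMoment {m q : ℕ} {Ω : Type*} [MeasurableSpace Ω] (μ : Measure Ω)
    (S : Ω → Matrix (Fin m) (Fin q) ℝ) : Matrix (Fin m) (Fin m) ℝ :=
  Matrix.of fun i j => ∫ ω, (S ω * (S ω)ᵀ) i j ∂μ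

/-- The matrix `H = E[S Sᵀ / ‖Sᵀ A‖₂²]`, with `0 / 0 = 0`. -/
noncomputable def sketchH {m n q : ℕ} {Ω : Type*} [MeasurableSpace Ω]
    (A : Matrix (Fin m) (Fin n) ℝ) (μ : Measure Ω)
    (S : Ω → Matrix (Fin m) (Fin q) ℝ) : Matrix (Fin m) (Fin m) ℝ :=
  Matrix.of fun i j => ∫ ω, (S ω * (S ω)ᵀ) i j / specNorm ((S ω)ᵀ * A) ^ 2 ∂μ

/-- `S` is a random matrix for which `E[S Sᵀ]` exists and is positive definite. -/
structure IsSketch {m q : ℕ} {Ω : Type*} [MeasurableSpace Ω] (μ : Measure Ω)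
    (S : Ω → Matrix (Fin m) (Fin q) ℝ) : Prop where
  measurable : Measurable S
  integrable : ∀ i j, Integrable (fun ω => (S ω * (S ω)ᵀ) i j) μ
  posDef : (secondMoment μ S).PosDef

/-- `E[S Sᵀ / ‖Sᵀ A‖₂²]` is a meaningful expectation: almost surely the quotient is not of the
form `nonzero / 0` (only `0 / 0`, read as `0`, is allowed), and it is integrable. -/
structure QuotientWellDefined {m n q : ℕ} {Ω : Type*} [MeasurableSpace Ω]
    (A : Matrix (Fin m) (Fin n) ℝ) (μ : Measure Ω)
    (S : Ω → Matrix (Fin m) (Fin q) ℝ) : Prop where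
  eq_zero : ∀ᵐ ω ∂μ, (S ω)ᵀ * A = 0 → S ω = 0
  integrable : ∀ i j,
    Integrable (fun ω => (S ω * (S ω)ᵀ) i j / specNorm ((S ω)ᵀ * A) ^ 2) μ

/-- The iterates `x^{k+1} = x^k - α Aᵀ S_k S_kᵀ (A x^k - B |x^k| - b) / ‖S_kᵀ A‖₂²`
(with `0 / 0 = 0`), started at the deterministic point `x0`. -/
noncomputable def iterate {m n q : ℕ} {Ω : Type*} (A B : Matrix (Fin m) (Fin n) ℝ)
    (b : EuclideanSpace ℝ (Fin m)) (α : ℝ) (S : ℕ → Ω → Matrix (Fin m) (Fin q) ℝ)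
    (x0 : EuclideanSpace ℝ (Fin n)) : ℕ → Ω → EuclideanSpace ℝ (Fin n)
  | 0, _ => x0
  | k + 1, ω =>
      iterate A B b α S x0 k ω -
        (α / specNorm ((S k ω)ᵀ * A) ^ 2) •
          Matrix.toEuclideanLin (Aᵀ * S k ω * (S k ω)ᵀ)
            (residual A B b (iterate A B b α S x0 k ω))

end GAVE

open scoped ENNReal

namespace GAVE

/-! ### Linear algebra -/

/-! Fix a solution `z` and write `r` for the residual at `x`. Expanding the square of one step and
averaging over the sketch replaces the random quotient by `H` (`norm_sketchStep_sub_sq_le`). Since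
`r = A(x - z) - B(|x| - |z|)` and `|·|` is 1-Lipschitz, polarisation in the `H`-inner product bounds
the cross term (`le_two_mul_inner_residual`), giving E‖x⁺ - z‖² ≤ (1 - α(σ² - β²))‖x - z‖² - α(1 -
α)⟨r, Hr⟩.

All three claims follow from this inequality (`lintegral_norm_sketchStep_sub_sq_le`). If σ = β, then
‖x^k - z‖² is a nonnegative supermartingale whose decrements are summable in mean, so r → 0 almost
surely, and a Fejér argument gives convergence. If σ > β, then ⟨r, Hr⟩ ≥ (σ - β)²‖x - z‖²; under the
error bound, ⟨r, Hr⟩ ≥ λκ² dist². In both cases the inequality becomes a contraction, iterated using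
the independence of the draws. -/

theorem mul_norm_sq_le_inner_of_le_eigenvalues {E : Type*} [NormedAddCommGroup E]
    [InnerProductSpace ℝ E] [FiniteDimensional ℝ E] {T : E →ₗ[ℝ] E} (hT : T.IsSymmetric) {n : ℕ}
    (hn : Module.finrank ℝ E = n) {c : ℝ} (hc : ∀ i, c ≤ hT.eigenvalues hn i) (x : E) :
    c * ‖x‖ ^ 2 ≤ inner ℝ x (T x) := by
  set e := hT.eigenvectorBasis hn with he
  rw [← e.sum_sq_norm_inner_right x, ← e.sum_inner_mul_inner x (T x), Finset.mul_sum]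
  refine Finset.sum_le_sum fun i _ => ?_
  have h1 : inner ℝ (e i) (T x) = hT.eigenvalues hn i * inner ℝ (e i) x := by
    rw [← hT, he, hT.apply_eigenvectorBasis, inner_smul_left]; simp
  rw [h1, real_inner_comm x (e i), Real.norm_eq_abs, sq_abs]
  nlinarith [mul_le_mul_of_nonneg_right (hc i) (sq_nonneg (inner ℝ x (e i)))]

theorem sigmaN_nonneg {m n : ℕ} (M : Matrix (Fin m) (Fin n) ℝ) : 0 ≤ sigmaN M :=
  LinearMap.singularValues_nonneg _ _

theorem sigmaN_mul_norm_le {m n : ℕ} (M : Matrix (Fin m) (Fin n) ℝ)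
    (x : EuclideanSpace ℝ (Fin n)) : sigmaN M * ‖x‖ ≤ ‖Matrix.toEuclideanLin M x‖ := by
  rcases Nat.eq_zero_or_pos n with rfl | hn
  -- For `n = 0` the index `n - 1` truncates to `0` and is not a valid eigenvalue index, but the
  -- space is trivial.
  · simp [Subsingleton.elim x 0]
  set T := Matrix.toEuclideanLin M
  have hf : Module.finrank ℝ (EuclideanSpace ℝ (Fin n)) = n := by simp
  have h := mul_norm_sq_le_inner_of_le_eigenvalues T.isSymmetric_adjoint_comp_self hf
    (c := sigmaN M ^ 2) (fun i => by
      rw [sigmaN, LinearMap.sq_singularValues_of_lt _ hf (by lia : n - 1 < n)]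
      -- Eigenvalues are listed in decreasing order, so the one at `n - 1` is the least.
      exact T.isSymmetric_adjoint_comp_self.eigenvalues_antitone hf
        (by rw [Fin.le_def]; simp only; lia)) x
  rw [LinearMap.comp_apply, LinearMap.adjoint_inner_right, real_inner_self_eq_norm_sq,
    ← mul_pow] at h
  exact le_of_sq_le_sq h (norm_nonneg _)

theorem toEuclideanLin_mul_apply {l m n : ℕ} (M : Matrix (Fin l) (Fin m) ℝ)
    (N : Matrix (Fin m) (Fin n) ℝ) (x : EuclideanSpace ℝ (Fin n)) :
    Matrix.toEuclideanLin (M * N) x = Matrix.toEuclideanLin M (Matrix.toEuclideanLin N x) := by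
  simp [Matrix.toLpLin_apply, Matrix.mulVec_mulVec]

theorem inner_toEuclideanLin_transpose {m n : ℕ} (M : Matrix (Fin m) (Fin n) ℝ)
    (x : EuclideanSpace ℝ (Fin n)) (y : EuclideanSpace ℝ (Fin m)) :
    inner ℝ x (Matrix.toEuclideanLin Mᵀ y) = inner ℝ (Matrix.toEuclideanLin M x) y := by
  rw [← Matrix.conjTranspose_eq_transpose_of_trivial, Matrix.toEuclideanLin_conjTranspose_eq_adjoint,
    LinearMap.adjoint_inner_right]

section Norm

open scoped Matrix.Norms.L2Operator

theorem specNorm_nonneg {m n : ℕ} (M : Matrix (Fin m) (Fin n) ℝ) : 0 ≤ specNorm M :=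
  norm_nonneg _

theorem norm_toEuclideanLin_le {m n : ℕ} (M : Matrix (Fin m) (Fin n) ℝ)
    (x : EuclideanSpace ℝ (Fin n)) : ‖Matrix.toEuclideanLin M x‖ ≤ specNorm M * ‖x‖ :=
  Matrix.l2_opNorm_mulVec M x

theorem specNorm_transpose {m n : ℕ} (M : Matrix (Fin m) (Fin n) ℝ) :
    specNorm Mᵀ = specNorm M := by
  rw [← Matrix.conjTranspose_eq_transpose_of_trivial]
  exact Matrix.l2_opNorm_conjTranspose M

theorem specNorm_eq_zero {m n : ℕ} {M : Matrix (Fin m) (Fin n) ℝ} : specNorm M = 0 ↔ M = 0 :=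
  norm_eq_zero

theorem continuous_specNorm {m n : ℕ} :
    Continuous (specNorm : Matrix (Fin m) (Fin n) ℝ → ℝ) :=
  continuous_norm

end Norm

/-! ### Quadratic forms, the square root and the least eigenvalue. -/

theorem inner_toEuclideanLin_eq_sum {m : ℕ} (Q : Matrix (Fin m) (Fin m) ℝ)
    (u v : EuclideanSpace ℝ (Fin m)) :
    inner ℝ u (Matrix.toEuclideanLin Q v) = ∑ i, ∑ j, u i * v j * Q i j := by
  simp only [PiLp.inner_apply, Matrix.toLpLin_apply, Matrix.mulVec, dotProduct]
  refine Finset.sum_congr rfl fun i _ => ?_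
  simp only [RCLike.inner_apply, conj_trivial, Finset.sum_mul]
  exact Finset.sum_congr rfl fun j _ => by ring

theorem psdSqrt_mul_self {m : ℕ} {H : Matrix (Fin m) (Fin m) ℝ} (hH : H.PosDef) :
    psdSqrt H * psdSqrt H = H := by
  have hs : IsSelfAdjoint H := hH.1
  rw [psdSqrt, ← cfc_mul (hf := by fun_prop) (hg := by fun_prop)]
  conv_rhs => rw [← cfc_id ℝ H]
  refine cfc_congr fun x hx => ?_
  rw [hH.1.spectrum_real_eq_range_eigenvalues] at hx
  obtain ⟨i, rfl⟩ := hx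
  exact Real.mul_self_sqrt (hH.eigenvalues_pos i).le

theorem psdSqrt_transpose {m : ℕ} (H : Matrix (Fin m) (Fin m) ℝ) :
    (psdSqrt H)ᵀ = psdSqrt H := by
  rw [← Matrix.conjTranspose_eq_transpose_of_trivial]
  exact (cfc_predicate (R := ℝ) (p := IsSelfAdjoint) Real.sqrt H).star_eq

/-- `⟨u, H v⟩ = ⟨H^{1/2} u, H^{1/2} v⟩`. -/
theorem inner_toEuclideanLin_eq_inner_psdSqrt {m : ℕ} {H : Matrix (Fin m) (Fin m) ℝ}
    (hH : H.PosDef) (u v : EuclideanSpace ℝ (Fin m)) :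
    inner ℝ u (Matrix.toEuclideanLin H v) =
      inner ℝ (Matrix.toEuclideanLin (psdSqrt H) u) (Matrix.toEuclideanLin (psdSqrt H) v) := by
  rw [← inner_toEuclideanLin_transpose, psdSqrt_transpose, ← toEuclideanLin_mul_apply,
    psdSqrt_mul_self hH]

theorem inner_toEuclideanLin_pos {m : ℕ} {H : Matrix (Fin m) (Fin m) ℝ}
    (hH : H.PosDef) {v : EuclideanSpace ℝ (Fin m)} (hv : v ≠ 0) :
    0 < inner ℝ v (Matrix.toEuclideanLin H v) := by
  have := hH.dotProduct_mulVec_pos (x := v.ofLp) (by simpa using hv)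
  rw [inner_toEuclideanLin_eq_sum]
  simp only [dotProduct, Matrix.mulVec, Finset.mul_sum, Pi.star_apply, star_trivial] at this
  exact this.trans_eq (Finset.sum_congr rfl fun i _ => Finset.sum_congr rfl fun j _ => by ring)

theorem lambdaMin_mem_spectrum {m : ℕ} (hm : 0 < m) {H : Matrix (Fin m) (Fin m) ℝ}
    (hH : H.PosDef) : lambdaMin H ∈ spectrum ℝ H := by
  have : Nonempty (Fin m) := ⟨⟨0, hm⟩⟩
  have h := hH.1.spectrum_real_eq_range_eigenvalues
  rw [lambdaMin]
  -- The infimum is attained because the spectrum is finite, and nonempty since `0 < m`.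
  refine Set.Nonempty.csInf_mem ?_ ?_
  · rw [h]; exact Set.range_nonempty _
  · rw [h]; exact Set.finite_range _

theorem lambdaMin_pos {m : ℕ} (hm : 0 < m) {H : Matrix (Fin m) (Fin m) ℝ}
    (hH : H.PosDef) : 0 < lambdaMin H := by
  have h := lambdaMin_mem_spectrum hm hH
  rw [hH.1.spectrum_real_eq_range_eigenvalues] at h
  obtain ⟨i, hi⟩ := h
  rw [← hi]
  exact hH.eigenvalues_pos i

theorem lambdaMin_mul_norm_sq_le {m : ℕ} {H : Matrix (Fin m) (Fin m) ℝ}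
    (hH : H.PosDef) (v : EuclideanSpace ℝ (Fin m)) :
    lambdaMin H * ‖v‖ ^ 2 ≤ inner ℝ v (Matrix.toEuclideanLin H v) := by
  have hT : (Matrix.toEuclideanLin H).IsSymmetric := Matrix.isSymmetric_toEuclideanLin_iff.2 hH.1
  refine mul_norm_sq_le_inner_of_le_eigenvalues hT (n := m) (by simp) (fun i => ?_) v
  refine csInf_le ?_ ?_
  · rw [hH.1.spectrum_real_eq_range_eigenvalues]; exact (Set.finite_range _).bddBelow
  · have := (hT.hasEigenvalue_eigenvalues (by simp) i).mem_spectrum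
    rwa [Matrix.spectrum_toLpLin] at this

/-! ### The equation -/

section Equation

variable {m n : ℕ} {A B : Matrix (Fin m) (Fin n) ℝ} {b : EuclideanSpace ℝ (Fin m)}

theorem norm_absVec_sub_le (x y : EuclideanSpace ℝ (Fin n)) :
    ‖absVec x - absVec y‖ ≤ ‖x - y‖ := by
  rw [EuclideanSpace.norm_eq, EuclideanSpace.norm_eq]
  refine Real.sqrt_le_sqrt (Finset.sum_le_sum fun i _ => ?_)
  have : |(|x i| - |y i|)| ≤ |x i - y i| := abs_abs_sub_abs_le_abs_sub _ _
  simp only [absVec, PiLp.sub_apply, Real.norm_eq_abs]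
  gcongr

theorem continuous_absVec : Continuous (absVec : EuclideanSpace ℝ (Fin n) → _) :=
  (LipschitzWith.of_dist_le_mul (K := 1) fun x y => by
    simpa [dist_eq_norm] using norm_absVec_sub_le x y).continuous

theorem continuous_residual : Continuous (residual A B b) := by
  have h1 := (Matrix.toEuclideanLin A).continuous_of_finiteDimensional
  have h2 := (Matrix.toEuclideanLin B).continuous_of_finiteDimensional
  exact (h1.sub (h2.comp continuous_absVec)).sub continuous_const

theorem residual_eq_zero_iff {x : EuclideanSpace ℝ (Fin n)} :
    residual A B b x = 0 ↔ x ∈ solutionSet A B b := by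
  simp [residual, solutionSet, sub_eq_zero]

theorem isClosed_solutionSet : IsClosed (solutionSet A B b) := by
  have : solutionSet A B b = residual A B b ⁻¹' {0} := by
    ext x; simp [residual_eq_zero_iff]
  rw [this]
  exact isClosed_singleton.preimage continuous_residual

/-- Subtracting the equation at `z` eliminates `b`; both lower estimates below start from this
identity. -/
theorem residual_add_eq {x z : EuclideanSpace ℝ (Fin n)} (hz : z ∈ solutionSet A B b) :
    residual A B b x + Matrix.toEuclideanLin B (absVec x - absVec z) =
      Matrix.toEuclideanLin A (x - z) := by
  have hz' : Matrix.toEuclideanLin A z - Matrix.toEuclideanLin B (absVec z) = b := hz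
  rw [residual, ← hz', map_sub, map_sub]
  abel

/-- Polarisation estimate for the cross term of one step. -/
theorem le_two_mul_inner_residual {H : Matrix (Fin m) (Fin m) ℝ} (hH : H.PosDef)
    {x z : EuclideanSpace ℝ (Fin n)} (hz : z ∈ solutionSet A B b) :
    (sigmaN (psdSqrt H * A) ^ 2 - specNorm (psdSqrt H * B) ^ 2) * ‖x - z‖ ^ 2 +
        inner ℝ (residual A B b x) (Matrix.toEuclideanLin H (residual A B b x)) ≤
      2 * inner ℝ (Matrix.toEuclideanLin A (x - z))
        (Matrix.toEuclideanLin H (residual A B b x)) := by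
  set R := psdSqrt H
  set r := residual A B b x with hr
  set d := absVec x - absVec z with hd
  rw [inner_toEuclideanLin_eq_inner_psdSqrt hH, inner_toEuclideanLin_eq_inner_psdSqrt hH]
  have hA := sigmaN_mul_norm_le (R * A) (x - z)
  have hB : ‖Matrix.toEuclideanLin (R * B) d‖ ≤ specNorm (R * B) * ‖x - z‖ :=
    (norm_toEuclideanLin_le _ _).trans
      (mul_le_mul_of_nonneg_left (norm_absVec_sub_le x z) (specNorm_nonneg _))
  have hA2 := pow_le_pow_left₀ (mul_nonneg (sigmaN_nonneg (R * A)) (norm_nonneg (x - z))) hA 2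
  have hB2 := pow_le_pow_left₀ (norm_nonneg _) hB 2
  rw [toEuclideanLin_mul_apply] at hA2 hB2
  have hsum : Matrix.toEuclideanLin R (Matrix.toEuclideanLin B d) =
      Matrix.toEuclideanLin R (Matrix.toEuclideanLin A (x - z)) - Matrix.toEuclideanLin R r := by
    rw [← residual_add_eq hz, map_add]; abel
  -- With `a = R A(x - z)`, this is 2⟨a, Rr⟩ = ‖a‖² + ‖Rr‖² - ‖a - Rr‖², where the last vector is `R
  -- B d`.
  rw [hsum, norm_sub_sq_real] at hB2
  rw [real_inner_self_eq_norm_sq]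
  nlinarith

/-- The triangle inequality applied to `residual_add_eq`. For σ > β it yields both the uniqueness of
the solution and the contraction. -/
theorem sub_mul_norm_le_residual {H : Matrix (Fin m) (Fin m) ℝ}
    {x z : EuclideanSpace ℝ (Fin n)} (hz : z ∈ solutionSet A B b) :
    (sigmaN (psdSqrt H * A) - specNorm (psdSqrt H * B)) * ‖x - z‖ ≤
      ‖Matrix.toEuclideanLin (psdSqrt H) (residual A B b x)‖ := by
  set R := psdSqrt H
  have hA := sigmaN_mul_norm_le (R * A) (x - z)
  have hB : ‖Matrix.toEuclideanLin (R * B) (absVec x - absVec z)‖ ≤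
      specNorm (R * B) * ‖x - z‖ :=
    (norm_toEuclideanLin_le _ _).trans
      (mul_le_mul_of_nonneg_left (norm_absVec_sub_le x z) (specNorm_nonneg _))
  rw [toEuclideanLin_mul_apply] at hA hB
  rw [← residual_add_eq hz, map_add] at hA
  have := norm_add_le (Matrix.toEuclideanLin R (residual A B b x))
    (Matrix.toEuclideanLin R (Matrix.toEuclideanLin B (absVec x - absVec z)))
  linarith

/-- Fejér-type convergence: if the residuals tend to zero and the distances to a dense set of
solutions converge, then the whole sequence converges to a solution. -/
theorem exists_tendsto_of_tendsto_norm_sub {x : ℕ → EuclideanSpace ℝ (Fin n)}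
    (hX : (solutionSet A B b).Nonempty) {D : Set (EuclideanSpace ℝ (Fin n))}
    (hcl : solutionSet A B b ⊆ closure D)
    (hD : ∀ z ∈ D, ∃ c, Tendsto (fun k => ‖x k - z‖) atTop (𝓝 c))
    (hr : Tendsto (fun k => residual A B b (x k)) atTop (𝓝 0)) :
    ∃ y ∈ solutionSet A B b, Tendsto x atTop (𝓝 y) := by
  obtain ⟨w, hw⟩ := hX
  obtain ⟨z, hz⟩ : D.Nonempty := closure_nonempty_iff.1 ⟨w, hcl hw⟩
  obtain ⟨c, hc⟩ := hD z hz
  obtain ⟨M, hM⟩ := hc.bddAbove_range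
  have hmem : ∀ k, x k ∈ Metric.closedBall z M := fun k => by
    rw [mem_closedBall_iff_norm]; exact hM ⟨k, rfl⟩
  obtain ⟨y, -, φ, hφ, hy⟩ := (isCompact_closedBall z M).tendsto_subseq hmem
  have hyX : y ∈ solutionSet A B b := by
    rw [← residual_eq_zero_iff]
    exact tendsto_nhds_unique ((continuous_residual.tendsto y).comp hy)
      (hr.comp hφ.tendsto_atTop)
  refine ⟨y, hyX, Metric.tendsto_atTop'.2 fun ε hε => ?_⟩
  -- The cluster point `y` need not lie in `D`, so distances are compared through a nearby `z'` in
  -- `D`; the subsequence identifies their limit as ‖y - z'‖ < ε/2.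
  obtain ⟨z', hz', hyz⟩ := Metric.mem_closure_iff.1 (hcl hyX) (ε / 2) (half_pos hε)
  obtain ⟨c', hc'⟩ := hD z' hz'
  have hc'y : c' = ‖y - z'‖ :=
    tendsto_nhds_unique (hc'.comp hφ.tendsto_atTop) (hy.sub_const z').norm
  rw [dist_eq_norm] at hyz
  obtain ⟨N, hN⟩ := eventually_atTop.1 (hc'.eventually_lt_const (hc'y.trans_lt hyz))
  refine ⟨N, fun k hk => ?_⟩
  have h1 := hN k hk.le
  calc dist (x k) y ≤ dist (x k) z' + dist z' y := dist_triangle _ _ _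
    _ < ε / 2 + ε / 2 := by
        rw [dist_eq_norm, dist_comm, dist_eq_norm]; exact add_lt_add h1 hyz
    _ = ε := add_halves ε

end Equation

/-! ### One step of the method -/

instance matrixBorelSpace (m q : ℕ) : BorelSpace (Matrix (Fin m) (Fin q) ℝ) :=
  inferInstanceAs (BorelSpace (Fin m → Fin q → ℝ))

instance matrixSecondCountableTopology (m q : ℕ) :
    SecondCountableTopology (Matrix (Fin m) (Fin q) ℝ) :=
  inferInstanceAs (SecondCountableTopology (Fin m → Fin q → ℝ))

/-- One step of the method with the sketching matrix `s`, started at `x`. -/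
noncomputable def sketchStep {m n q : ℕ} (A B : Matrix (Fin m) (Fin n) ℝ)
    (b : EuclideanSpace ℝ (Fin m)) (α : ℝ) (s : Matrix (Fin m) (Fin q) ℝ)
    (x : EuclideanSpace ℝ (Fin n)) : EuclideanSpace ℝ (Fin n) :=
  x - (α / specNorm (sᵀ * A) ^ 2) • Matrix.toEuclideanLin (Aᵀ * s * sᵀ) (residual A B b x)

/-- The normalised matrix `s sᵀ / ‖sᵀ A‖₂²`, with `0 / 0 = 0`. -/
noncomputable def sketchQuotient {m n q : ℕ} (A : Matrix (Fin m) (Fin n) ℝ)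
    (s : Matrix (Fin m) (Fin q) ℝ) : Matrix (Fin m) (Fin m) ℝ :=
  Matrix.of fun i j => (s * sᵀ) i j / specNorm (sᵀ * A) ^ 2

section Step

variable {m n q : ℕ} {A B : Matrix (Fin m) (Fin n) ℝ} {b : EuclideanSpace ℝ (Fin m)} {α : ℝ}

theorem inner_sketchQuotient (s : Matrix (Fin m) (Fin q) ℝ) (u v : EuclideanSpace ℝ (Fin m)) :
    inner ℝ u (Matrix.toEuclideanLin (sketchQuotient A s) v) =
      inner ℝ u (Matrix.toEuclideanLin (s * sᵀ) v) / specNorm (sᵀ * A) ^ 2 := by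
  simp only [inner_toEuclideanLin_eq_sum, sketchQuotient, Matrix.of_apply, Finset.sum_div,
    mul_div_assoc]

theorem inner_mul_transpose_self (s : Matrix (Fin m) (Fin q) ℝ) (v : EuclideanSpace ℝ (Fin m)) :
    inner ℝ v (Matrix.toEuclideanLin (s * sᵀ) v) = ‖Matrix.toEuclideanLin sᵀ v‖ ^ 2 := by
  rw [toEuclideanLin_mul_apply, ← real_inner_self_eq_norm_sq, ← inner_toEuclideanLin_transpose,
    Matrix.transpose_transpose]

/-- The step may be discontinuous where `sᵀ A = 0`, so measurability comes from a quotient of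
continuous maps. Joint measurability is what Tonelli's theorem needs later. -/
theorem measurable_sketchStep :
    Measurable fun p : Matrix (Fin m) (Fin q) ℝ × EuclideanSpace ℝ (Fin n) =>
      sketchStep A B b α p.1 p.2 := by
  have h1 : Continuous fun p : Matrix (Fin m) (Fin q) ℝ × EuclideanSpace ℝ (Fin n) =>
      specNorm (p.1ᵀ * A) ^ 2 := by
    have := continuous_specNorm (m := q) (n := n)
    fun_prop
  have h2 : Continuous fun p : Matrix (Fin m) (Fin q) ℝ × EuclideanSpace ℝ (Fin n) =>
      Matrix.toEuclideanLin (Aᵀ * p.1 * p.1ᵀ) (residual A B b p.2) := by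
    have := continuous_residual (A := A) (B := B) (b := b)
    simp only [Matrix.toLpLin_apply]
    fun_prop
  exact measurable_snd.sub ((measurable_const.div h1.measurable).smul h2.measurable)

/-- In the quadratic term, ‖Aᵀ s sᵀ r‖ ≤ ‖sᵀ A‖ ‖sᵀ r‖ cancels one of the two factors ‖sᵀ A‖² in the
denominator. -/
theorem norm_sketchStep_sub_sq_le (s : Matrix (Fin m) (Fin q) ℝ)
    (x z : EuclideanSpace ℝ (Fin n)) :
    ‖sketchStep A B b α s x - z‖ ^ 2 ≤ ‖x - z‖ ^ 2 -
        2 * α * inner ℝ (Matrix.toEuclideanLin A (x - z))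
          (Matrix.toEuclideanLin (sketchQuotient A s) (residual A B b x)) +
        α ^ 2 * inner ℝ (residual A B b x)
          (Matrix.toEuclideanLin (sketchQuotient A s) (residual A B b x)) := by
  set r := residual A B b x with hr
  set c := specNorm (sᵀ * A) with hc
  have hw : Matrix.toEuclideanLin (Aᵀ * s * sᵀ) r =
      Matrix.toEuclideanLin Aᵀ (Matrix.toEuclideanLin (s * sᵀ) r) := by
    rw [Matrix.mul_assoc, toEuclideanLin_mul_apply]
  have hwn : ‖Matrix.toEuclideanLin (Aᵀ * s * sᵀ) r‖ ≤ c * ‖Matrix.toEuclideanLin sᵀ r‖ := by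
    rw [toEuclideanLin_mul_apply, hc, ← specNorm_transpose, Matrix.transpose_mul,
      Matrix.transpose_transpose]
    exact norm_toEuclideanLin_le _ _
  have h1 : sketchStep A B b α s x - z =
      (x - z) - (α / c ^ 2) • Matrix.toEuclideanLin (Aᵀ * s * sᵀ) r := by
    rw [sketchStep]; abel
  rw [h1, norm_sub_sq_real, inner_smul_right, norm_smul, mul_pow, Real.norm_eq_abs, sq_abs,
    inner_sketchQuotient, inner_sketchQuotient, inner_mul_transpose_self, hw,
    inner_toEuclideanLin_transpose, ← hw, ← hc]
  have h2 : (α / c ^ 2) ^ 2 * ‖Matrix.toEuclideanLin (Aᵀ * s * sᵀ) r‖ ^ 2 ≤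
      α ^ 2 * (‖Matrix.toEuclideanLin sᵀ r‖ ^ 2 / c ^ 2) := by
    refine (mul_le_mul_of_nonneg_left (pow_le_pow_left₀ (norm_nonneg _) hwn 2)
      (sq_nonneg _)).trans_eq ?_
    -- For `c = 0` division by zero makes both sides vanish.
    rcases eq_or_ne c 0 with h0 | h0
    · simp [h0]
    · field_simp
  have h3 : 2 * (α / c ^ 2 * inner ℝ (Matrix.toEuclideanLin A (x - z))
        (Matrix.toEuclideanLin (s * sᵀ) r)) =
      2 * α * (inner ℝ (Matrix.toEuclideanLin A (x - z))
        (Matrix.toEuclideanLin (s * sᵀ) r) / c ^ 2) := by ring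
  linarith

end Step

/-! ### Averaging one step over the sketch. -/

section Expectation

variable {m n q : ℕ} {A B : Matrix (Fin m) (Fin n) ℝ} {b : EuclideanSpace ℝ (Fin m)} {α : ℝ}
  {Ω : Type*} [MeasurableSpace Ω] {μ : Measure Ω} {S : Ω → Matrix (Fin m) (Fin q) ℝ}

theorem integrable_inner_toEuclideanLin {M : Ω → Matrix (Fin m) (Fin m) ℝ}
    (hM : ∀ i j, Integrable (fun ω => M ω i j) μ) (u v : EuclideanSpace ℝ (Fin m)) :
    Integrable (fun ω => inner ℝ u (Matrix.toEuclideanLin (M ω) v)) μ := by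
  simp only [inner_toEuclideanLin_eq_sum]
  exact integrable_finsetSum _ fun i _ => integrable_finsetSum _ fun j _ => (hM i j).const_mul _

theorem integral_inner_toEuclideanLin {M : Ω → Matrix (Fin m) (Fin m) ℝ}
    (hM : ∀ i j, Integrable (fun ω => M ω i j) μ) (u v : EuclideanSpace ℝ (Fin m)) :
    ∫ ω, inner ℝ u (Matrix.toEuclideanLin (M ω) v) ∂μ =
      inner ℝ u (Matrix.toEuclideanLin (Matrix.of fun i j => ∫ ω, M ω i j ∂μ) v) := by
  simp only [inner_toEuclideanLin_eq_sum, Matrix.of_apply]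
  rw [integral_finsetSum _ fun i _ => integrable_finsetSum _ fun j _ => (hM i j).const_mul _]
  refine Finset.sum_congr rfl fun i _ => ?_
  rw [integral_finsetSum _ fun j _ => (hM i j).const_mul _]
  exact Finset.sum_congr rfl fun j _ => integral_const_mul _ _

/-- If E[‖Sᵀw‖²/‖SᵀA‖²] = 0, then almost surely `Sᵀw = 0` or `SᵀA = 0`. The latter forces `S = 0`,
so E‖Sᵀw‖² = 0, contradicting the definiteness of the second moment. -/
theorem posDef_sketchH (hS : IsSketch μ S) (hSA : QuotientWellDefined A μ S) :
    (sketchH A μ S).PosDef := by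
  have hQ : ∀ i j, Integrable (fun ω => sketchQuotient A (S ω) i j) μ := hSA.integrable
  refine Matrix.PosDef.of_dotProduct_mulVec_pos ?_ fun v hv => ?_
  · ext i j
    simp only [Matrix.conjTranspose_apply, star_trivial, sketchH, Matrix.of_apply]
    have h (ω : Ω) : (S ω * (S ω)ᵀ) j i = (S ω * (S ω)ᵀ) i j := by
      simp [Matrix.mul_apply, mul_comm]
    simp only [h]
  set w : EuclideanSpace ℝ (Fin m) := WithLp.toLp 2 v with hw
  have hw0 : w ≠ 0 := by simpa [hw] using hv
  have hgoal : star v ⬝ᵥ sketchH A μ S *ᵥ v =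
      inner ℝ w (Matrix.toEuclideanLin (sketchH A μ S) w) := by
    rw [inner_toEuclideanLin_eq_sum]
    simp only [dotProduct, Matrix.mulVec, Finset.mul_sum, Pi.star_apply, star_trivial, hw]
    exact Finset.sum_congr rfl fun i _ => Finset.sum_congr rfl fun j _ => by ring
  have hint := integral_inner_toEuclideanLin hQ w w
  have hnn : 0 ≤ fun ω => inner ℝ w (Matrix.toEuclideanLin (sketchQuotient A (S ω)) w) := by
    intro ω
    simp only [inner_sketchQuotient, inner_mul_transpose_self, Pi.zero_apply]
    positivity
  rw [hgoal]
  change 0 < inner ℝ w (Matrix.toEuclideanLin (Matrix.of fun i j =>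
    ∫ ω, sketchQuotient A (S ω) i j ∂μ) w)
  rw [← hint]
  refine lt_of_le_of_ne (integral_nonneg hnn) fun h0 => ?_
  have hae := (integral_eq_zero_iff_of_nonneg hnn (integrable_inner_toEuclideanLin hQ w w)).1 h0.symm
  have hpos := inner_toEuclideanLin_pos hS.posDef hw0
  rw [secondMoment, ← integral_inner_toEuclideanLin hS.integrable] at hpos
  refine hpos.ne' (integral_eq_zero_of_ae ?_)
  filter_upwards [hae, hSA.eq_zero] with ω h1 h2
  simp only [inner_sketchQuotient, Pi.zero_apply, div_eq_zero_iff] at h1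
  rcases h1 with h1 | h1
  · exact h1
  · rw [h2 (specNorm_eq_zero.1 (by simpa using h1))]; simp

/-- Expected squared distance to a solution after one step. -/
theorem lintegral_norm_sketchStep_sub_sq_le [IsProbabilityMeasure μ] (hS : IsSketch μ S)
    (hSA : QuotientWellDefined A μ S) (hα : 0 ≤ α) {x z : EuclideanSpace ℝ (Fin n)}
    (hz : z ∈ solutionSet A B b) {C : ℝ}
    (hC : (1 - α * (sigmaN (psdSqrt (sketchH A μ S) * A) ^ 2 -
        specNorm (psdSqrt (sketchH A μ S) * B) ^ 2)) * ‖x - z‖ ^ 2 -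
      α * (1 - α) * inner ℝ (residual A B b x)
        (Matrix.toEuclideanLin (sketchH A μ S) (residual A B b x)) ≤ C) :
    0 ≤ C ∧ ∫⁻ ω, ENNReal.ofReal (‖sketchStep A B b α (S ω) x - z‖ ^ 2) ∂μ ≤
      ENNReal.ofReal C := by
  set r := residual A B b x with hr
  set H := sketchH A μ S with hH
  set u := Matrix.toEuclideanLin A (x - z) with hu
  have hQ : ∀ i j, Integrable (fun ω => sketchQuotient A (S ω) i j) μ := hSA.integrable
  have hI := fun u v => integrable_inner_toEuclideanLin hQ u v
  have hE : ∀ u v, ∫ ω, inner ℝ u (Matrix.toEuclideanLin (sketchQuotient A (S ω)) v) ∂μ =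
      inner ℝ u (Matrix.toEuclideanLin H v) := integral_inner_toEuclideanLin hQ
  set F : Ω → ℝ := fun ω => ‖x - z‖ ^ 2 -
    2 * α * inner ℝ u (Matrix.toEuclideanLin (sketchQuotient A (S ω)) r) +
    α ^ 2 * inner ℝ r (Matrix.toEuclideanLin (sketchQuotient A (S ω)) r) with hF
  have hle : ∀ ω, ‖sketchStep A B b α (S ω) x - z‖ ^ 2 ≤ F ω := fun ω =>
    norm_sketchStep_sub_sq_le (S ω) x z
  have hF0 : ∀ ω, 0 ≤ F ω := fun ω => (sq_nonneg _).trans (hle ω)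
  have hi1 : Integrable (fun ω => ‖x - z‖ ^ 2 -
      2 * α * inner ℝ u (Matrix.toEuclideanLin (sketchQuotient A (S ω)) r)) μ :=
    (integrable_const _).sub ((hI u r).const_mul (2 * α))
  have hi2 := (hI r r).const_mul (α ^ 2)
  have hFi : Integrable F μ := hi1.add hi2
  have hFE : ∫ ω, F ω ∂μ = ‖x - z‖ ^ 2 - 2 * α * inner ℝ u (Matrix.toEuclideanLin H r) +
      α ^ 2 * inner ℝ r (Matrix.toEuclideanLin H r) := by
    simp only [hF]
    rw [integral_add hi1 hi2, integral_sub (integrable_const _) ((hI u r).const_mul (2 * α)),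
      integral_const_mul, integral_const_mul, hE, hE]
    simp
  have hFC : ∫ ω, F ω ∂μ ≤ C := by
    have := mul_le_mul_of_nonneg_left
      (le_two_mul_inner_residual (posDef_sketchH hS hSA) (x := x) hz) hα
    rw [hFE]
    refine le_trans ?_ hC
    rw [← hu, ← hr, ← hH] at this
    linarith
  -- `C` dominates the mean of a nonnegative function, so `ENNReal.ofReal C` truncates nothing.
  refine ⟨(integral_nonneg hF0).trans hFC, ?_⟩
  calc ∫⁻ ω, ENNReal.ofReal (‖sketchStep A B b α (S ω) x - z‖ ^ 2) ∂μ
      ≤ ∫⁻ ω, ENNReal.ofReal (F ω) ∂μ :=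
        lintegral_mono fun ω => ENNReal.ofReal_le_ofReal (hle ω)
    _ = ENNReal.ofReal (∫ ω, F ω ∂μ) :=
        (ofReal_integral_eq_lintegral_ofReal hFi (ae_of_all _ hF0)).symm
    _ ≤ ENNReal.ofReal C := ENNReal.ofReal_le_ofReal hFC

end Expectation

/-! ### The random iterates -/

section Iterates

variable {m n q : ℕ} {A B : Matrix (Fin m) (Fin n) ℝ} {b : EuclideanSpace ℝ (Fin m)} {α : ℝ}
  {x0 : EuclideanSpace ℝ (Fin n)}
  {Ω : Type*} [MeasurableSpace Ω] {μ : Measure Ω} {S : Ω → Matrix (Fin m) (Fin q) ℝ}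
  {Ω' : Type*} [mΩ' : MeasurableSpace Ω'] {P : Measure Ω'}
  {Sk : ℕ → Ω' → Matrix (Fin m) (Fin q) ℝ}

/-- The filtration whose `k`-th sigma-algebra is generated by the draws before time `k`. -/
def pastFiltration (hmeas : ∀ k, Measurable (Sk k)) : Filtration ℕ mΩ' where
  seq k := ⨆ j ∈ Set.Iio k, MeasurableSpace.comap (Sk j) inferInstance
  mono' _ _ h := biSup_mono fun _ hj => lt_of_lt_of_le hj h
  le' _ := iSup₂_le fun j _ => (hmeas j).comap_le

theorem measurable_iterate (hmeas : ∀ k, Measurable (Sk k)) (k : ℕ) :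
    Measurable[pastFiltration hmeas k] (iterate A B b α Sk x0 k) := by
  induction k with
  | zero => exact measurable_const
  | succ k ih =>
    have h1 : Measurable[pastFiltration hmeas (k + 1)] (iterate A B b α Sk x0 k) :=
      ih.mono ((pastFiltration hmeas).mono k.le_succ) le_rfl
    have h2 : Measurable[pastFiltration hmeas (k + 1)] (Sk k) :=
      (comap_measurable (Sk k)).mono
        (le_iSup₂_of_le (f := fun j (_ : j ∈ Set.Iio (k + 1)) =>
          MeasurableSpace.comap (Sk j) inferInstance) k (Set.mem_Iio.2 k.lt_succ_self) le_rfl) le_rfl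
    exact (measurable_sketchStep (A := A) (B := B) (b := b) (α := α)).comp (h2.prodMk h1)

theorem measurable_iterate' (hmeas : ∀ k, Measurable (Sk k)) (k : ℕ) :
    Measurable (iterate A B b α Sk x0 k) :=
  (measurable_iterate hmeas k).mono ((pastFiltration hmeas).le k) le_rfl

theorem indep_pastFiltration (hmeas : ∀ k, Measurable (Sk k)) (hindep : iIndepFun Sk P) (k : ℕ) :
    Indep (pastFiltration hmeas k) (MeasurableSpace.comap (Sk k) inferInstance) P := by
  have := indep_iSup_of_disjoint (fun j => (hmeas j).comap_le) hindep.iIndep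
    (S := Set.Iio k) (T := {k}) (by simp)
  simp only [Set.mem_singleton_iff, iSup_iSup_eq_left] at this
  exact this

/-- Averaging over the `k`-th draw, which is independent of the past. -/
theorem setLIntegral_iterate_succ_le [IsProbabilityMeasure P] (hmeas : ∀ k, Measurable (Sk k))
    (hident : ∀ k, IdentDistrib (Sk k) S P μ) (hindep : iIndepFun Sk P)
    {g h : EuclideanSpace ℝ (Fin n) → ℝ≥0∞} (hg : Measurable g) (hh : Measurable h)
    (hgh : ∀ x, ∫⁻ ω, g (sketchStep A B b α (S ω) x) ∂μ ≤ h x) (k : ℕ) {s : Set Ω'}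
    (hs : MeasurableSet[pastFiltration hmeas k] s) :
    ∫⁻ ω in s, g (iterate A B b α Sk x0 (k + 1) ω) ∂P ≤
      ∫⁻ ω in s, h (iterate A B b α Sk x0 k ω) ∂P := by
  set X := iterate A B b α Sk x0 k with hX
  have hXm : Measurable X := measurable_iterate' hmeas k
  have hs' : MeasurableSet s := (pastFiltration hmeas).le k s hs
  -- Carrying the past event along as a coordinate lets a single product law, that of `U` and `Sk
  -- k`, handle both state and event.
  set U : Ω' → EuclideanSpace ℝ (Fin n) × ℝ≥0∞ := fun ω => (X ω, s.indicator 1 ω) with hU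
  have hUm : Measurable U := hXm.prodMk (measurable_one.indicator hs')
  have hUpast : Measurable[pastFiltration hmeas k] U :=
    (measurable_iterate hmeas k).prodMk (measurable_const.indicator hs)
  have hind : IndepFun U (Sk k) P := by
    rw [IndepFun_iff_Indep]
    exact indep_of_indep_of_le_left (indep_pastFiltration hmeas hindep k) hUpast.comap_le
  have hlaw := (indepFun_iff_map_prod_eq_prod_map_map hUm.aemeasurable
    (hmeas k).aemeasurable).1 hind
  set G : (EuclideanSpace ℝ (Fin n) × ℝ≥0∞) × Matrix (Fin m) (Fin q) ℝ → ℝ≥0∞ :=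
    fun p => p.1.2 * g (sketchStep A B b α p.2 p.1.1) with hG
  have hstep (x : EuclideanSpace ℝ (Fin n)) :
      Measurable fun M : Matrix (Fin m) (Fin q) ℝ => g (sketchStep A B b α M x) :=
    hg.comp (measurable_sketchStep.comp (measurable_id.prodMk measurable_const))
  have hGm : Measurable G :=
    measurable_fst.snd.mul (hg.comp (measurable_sketchStep.comp
      (measurable_snd.prodMk measurable_fst.fst)))
  have hind_mul (f : Ω' → ℝ≥0∞) :
      ∫⁻ ω in s, f ω ∂P = ∫⁻ ω, s.indicator 1 ω * f ω ∂P := by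
    rw [← lintegral_indicator hs']
    refine lintegral_congr fun ω => ?_
    by_cases hω : ω ∈ s <;> simp [hω]
  have hinner (u : EuclideanSpace ℝ (Fin n) × ℝ≥0∞) :
      ∫⁻ M, G (u, M) ∂(P.map (Sk k)) ≤ u.2 * h u.1 := by
    simp only [hG]
    rw [lintegral_const_mul _ (hstep u.1), (hident k).map_eq,
      lintegral_map' (hstep u.1).aemeasurable (hident k).aemeasurable_snd]
    gcongr
    exact hgh u.1
  have : IsProbabilityMeasure (P.map (Sk k)) :=
    Measure.isProbabilityMeasure_map (hmeas k).aemeasurable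
  calc ∫⁻ ω in s, g (iterate A B b α Sk x0 (k + 1) ω) ∂P
      = ∫⁻ ω, G (U ω, Sk k ω) ∂P := hind_mul _
    _ = ∫⁻ p, G p ∂(P.map fun ω => (U ω, Sk k ω)) :=
        (lintegral_map hGm (hUm.prodMk (hmeas k))).symm
    _ = ∫⁻ u, ∫⁻ M, G (u, M) ∂(P.map (Sk k)) ∂(P.map U) := by
        rw [hlaw, lintegral_prod _ hGm.aemeasurable]
    _ ≤ ∫⁻ u, u.2 * h u.1 ∂(P.map U) := lintegral_mono hinner
    _ = ∫⁻ ω, s.indicator 1 ω * h (X ω) ∂P :=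
        lintegral_map (measurable_snd.mul (hh.comp measurable_fst)) hUm
    _ = ∫⁻ ω in s, h (X ω) ∂P := (hind_mul _).symm

theorem lintegral_iterate_succ_le [IsProbabilityMeasure P] (hmeas : ∀ k, Measurable (Sk k))
    (hident : ∀ k, IdentDistrib (Sk k) S P μ) (hindep : iIndepFun Sk P)
    {g h : EuclideanSpace ℝ (Fin n) → ℝ≥0∞} (hg : Measurable g) (hh : Measurable h)
    (hgh : ∀ x, ∫⁻ ω, g (sketchStep A B b α (S ω) x) ∂μ ≤ h x) (k : ℕ) :
    ∫⁻ ω, g (iterate A B b α Sk x0 (k + 1) ω) ∂P ≤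
      ∫⁻ ω, h (iterate A B b α Sk x0 k ω) ∂P := by
  simpa using setLIntegral_iterate_succ_le (x0 := x0) hmeas hident hindep hg hh hgh k
    MeasurableSet.univ

/-- A one-step contraction of `g` in expectation gives linear convergence of `E[g(x^k)]`. -/
theorem integral_iterate_le_pow_mul [IsProbabilityMeasure P] (hmeas : ∀ k, Measurable (Sk k))
    (hident : ∀ k, IdentDistrib (Sk k) S P μ) (hindep : iIndepFun Sk P)
    {g : EuclideanSpace ℝ (Fin n) → ℝ} (hg : Measurable g) (hg0 : ∀ x, 0 ≤ g x) {ρ : ℝ}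
    (hρ : ∀ x, 0 ≤ ρ * g x ∧ ∫⁻ ω, ENNReal.ofReal (g (sketchStep A B b α (S ω) x)) ∂μ ≤
      ENNReal.ofReal (ρ * g x)) (k : ℕ) :
    Integrable (fun ω => g (iterate A B b α Sk x0 k ω)) P ∧
      ∫ ω, g (iterate A B b α Sk x0 k ω) ∂P ≤ ρ ^ k * g x0 := by
  -- A negative `ρ` with `0 ≤ ρ * g x` forces `g = 0`, so the induction may assume `ρ ≥ 0`.
  rcases lt_or_ge ρ 0 with hneg | hpos
  · have hz : ∀ x, g x = 0 := fun x => by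
      have := (hρ x).1
      nlinarith [hg0 x]
    simp [hz]
  have hgm : Measurable fun x => ENNReal.ofReal (g x) := hg.ennreal_ofReal
  have hkey : ∫⁻ ω, ENNReal.ofReal (g (iterate A B b α Sk x0 k ω)) ∂P ≤
      ENNReal.ofReal (ρ ^ k * g x0) := by
    induction k with
    | zero => simp [iterate]
    | succ k ih =>
      refine (lintegral_iterate_succ_le (x0 := x0) hmeas hident hindep hgm
        (hg.const_mul ρ).ennreal_ofReal (fun x => (hρ x).2) k).trans ?_
      simp only [ENNReal.ofReal_mul hpos]
      have hgX : Measurable fun ω => ENNReal.ofReal (g (iterate A B b α Sk x0 k ω)) :=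
        hgm.comp (measurable_iterate' hmeas k)
      rw [lintegral_const_mul _ hgX, pow_succ', mul_assoc,
        ENNReal.ofReal_mul hpos]
      gcongr
  have hm : AEStronglyMeasurable (fun ω => g (iterate A B b α Sk x0 k ω)) P :=
    (hg.comp (measurable_iterate' hmeas k)).aestronglyMeasurable
  have h0 : 0 ≤ᵐ[P] fun ω => g (iterate A B b α Sk x0 k ω) := ae_of_all _ fun _ => hg0 _
  refine ⟨⟨hm, (hasFiniteIntegral_iff_ofReal h0).2 (hkey.trans_lt ENNReal.ofReal_lt_top)⟩, ?_⟩
  rw [integral_eq_lintegral_of_nonneg_ae h0 hm]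
  exact ENNReal.toReal_le_of_le_ofReal (mul_nonneg (pow_nonneg hpos k) (hg0 _)) hkey

/-- Robbins–Siegmund type statement: if `E[g(x^{k+1}) | past] + h(x^k) ≤ g(x^k)`, then almost
surely `g(x^k)` converges and `h(x^k) → 0`. -/
theorem ae_tendsto_of_descent [IsProbabilityMeasure P] (hmeas : ∀ k, Measurable (Sk k))
    (hident : ∀ k, IdentDistrib (Sk k) S P μ) (hindep : iIndepFun Sk P)
    {g h : EuclideanSpace ℝ (Fin n) → ℝ} (hg : Measurable g) (hg0 : ∀ x, 0 ≤ g x)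
    (hh : Measurable h) (hh0 : ∀ x, 0 ≤ h x)
    (hgh : ∀ x, 0 ≤ g x - h x ∧ ∫⁻ ω, ENNReal.ofReal (g (sketchStep A B b α (S ω) x)) ∂μ ≤
      ENNReal.ofReal (g x - h x)) :
    ∀ᵐ ω ∂P, (∃ c, Tendsto (fun k => g (iterate A B b α Sk x0 k ω)) atTop (𝓝 c)) ∧
      Tendsto (fun k => h (iterate A B b α Sk x0 k ω)) atTop (𝓝 0) := by
  set X := iterate A B b α Sk x0 with hX
  have hXm : ∀ k, Measurable (X k) := measurable_iterate' hmeas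
  have hgm : Measurable fun x => ENNReal.ofReal (g x) := hg.ennreal_ofReal
  have hhm : Measurable fun x => ENNReal.ofReal (h x) := hh.ennreal_ofReal
  have hhX (k : ℕ) : Measurable fun ω => ENNReal.ofReal (h (X k ω)) := hhm.comp (hXm k)
  have hle : ∀ x, ∫⁻ ω, ENNReal.ofReal (g (sketchStep A B b α (S ω) x)) ∂μ ≤
      ENNReal.ofReal (g x) := fun x =>
    (hgh x).2.trans (ENNReal.ofReal_le_ofReal (by linarith [hh0 x]))
  have hdesc (k : ℕ) : ∫⁻ ω, ENNReal.ofReal (g (X (k + 1) ω)) ∂P +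
      ∫⁻ ω, ENNReal.ofReal (h (X k ω)) ∂P ≤ ∫⁻ ω, ENNReal.ofReal (g (X k ω)) ∂P := by
    have hsub : Measurable fun x => ENNReal.ofReal (g x - h x) := (hg.sub hh).ennreal_ofReal
    refine (add_le_add_left (lintegral_iterate_succ_le (x0 := x0) hmeas hident hindep hgm
      hsub (fun x => (hgh x).2) k) _).trans_eq ?_
    rw [← lintegral_add_right _ (hhX k)]
    refine lintegral_congr fun ω => ?_
    rw [← ENNReal.ofReal_add (hgh _).1 (hh0 _)]
    simp [hX]
  -- Telescoping bounds every `E[g(x^N)]`, for martingale convergence, and the sum of all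
  -- `E[h(x^k)]`, for almost sure summability.
  have hsum (N : ℕ) : ∑ k ∈ Finset.range N, ∫⁻ ω, ENNReal.ofReal (h (X k ω)) ∂P +
      ∫⁻ ω, ENNReal.ofReal (g (X N ω)) ∂P ≤ ENNReal.ofReal (g x0) := by
    induction N with
    | zero => simp [hX, iterate]
    | succ N ih =>
      rw [Finset.sum_range_succ, add_assoc, add_comm (∫⁻ ω, ENNReal.ofReal (h (X N ω)) ∂P)]
      exact (add_le_add_right (hdesc N) _).trans ih
  have hgbd (k : ℕ) : ∫⁻ ω, ENNReal.ofReal (g (X k ω)) ∂P ≤ ENNReal.ofReal (g x0) :=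
    le_add_self.trans (hsum k)
  have hint (k : ℕ) : Integrable (fun ω => g (X k ω)) P :=
    ⟨(hg.comp (hXm k)).aestronglyMeasurable, (hasFiniteIntegral_iff_ofReal
      (ae_of_all _ fun _ => hg0 _)).2 ((hgbd k).trans_lt ENNReal.ofReal_lt_top)⟩
  have hsuper : Supermartingale (fun k ω => g (X k ω)) (pastFiltration hmeas) P := by
    refine supermartingale_of_setIntegral_succ_le
      (fun k => (hg.comp (measurable_iterate hmeas k)).stronglyMeasurable) hint fun k s hs => ?_
    have h1 := setLIntegral_iterate_succ_le (x0 := x0) hmeas hident hindep hgm hgm hle k hs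
    rw [integral_eq_lintegral_of_nonneg_ae (ae_of_all _ fun _ => hg0 _)
        (hint (k + 1)).aestronglyMeasurable.restrict,
      integral_eq_lintegral_of_nonneg_ae (ae_of_all _ fun _ => hg0 _)
        (hint k).aestronglyMeasurable.restrict]
    refine ENNReal.toReal_mono (ne_top_of_le_ne_top ENNReal.ofReal_ne_top
      ((setLIntegral_le_lintegral _ _).trans (hgbd k))) h1
  have hconv : ∀ᵐ ω ∂P, ∃ c, Tendsto (fun k => -g (X k ω)) atTop (𝓝 c) := by
    refine hsuper.neg.exists_ae_tendsto_of_bdd (R := (g x0).toNNReal) fun k => ?_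
    rw [eLpNorm_one_eq_lintegral_enorm]
    refine le_trans (lintegral_mono fun ω => ?_) (hgbd k)
    rw [enorm_neg, Real.enorm_eq_ofReal (hg0 _)]
  have hzero : ∀ᵐ ω ∂P, ∑' k, ENNReal.ofReal (h (X k ω)) < ∞ := by
    refine ae_lt_top (Measurable.tsum hhX) ?_
    rw [lintegral_tsum fun k => (hhX k).aemeasurable]
    refine ne_top_of_le_ne_top (b := ENNReal.ofReal (g x0)) ENNReal.ofReal_ne_top ?_
    exact ENNReal.tsum_le_of_sum_range_le fun N => le_self_add.trans (hsum N)
  filter_upwards [hconv, hzero] with ω h1 h2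
  refine ⟨?_, ?_⟩
  · obtain ⟨c, hc⟩ := h1
    exact ⟨-c, by simpa using hc.neg⟩
  · have := (ENNReal.tendsto_toReal ENNReal.zero_ne_top).comp
      (ENNReal.tendsto_atTop_zero_of_tsum_ne_top h2.ne)
    simpa [Function.comp_def, ENNReal.toReal_ofReal (hh0 _)] using this

end Iterates

/-! ### The three convergence statements -/

section Convergence

variable {m n q : ℕ} {A B : Matrix (Fin m) (Fin n) ℝ} {b : EuclideanSpace ℝ (Fin m)} {α : ℝ}
  {x0 : EuclideanSpace ℝ (Fin n)}
  {Ω : Type*} [MeasurableSpace Ω] {μ : Measure Ω} [IsProbabilityMeasure μ]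
  {S : Ω → Matrix (Fin m) (Fin q) ℝ}
  {Ω' : Type*} [MeasurableSpace Ω'] {P : Measure Ω'} [IsProbabilityMeasure P]
  {Sk : ℕ → Ω' → Matrix (Fin m) (Fin q) ℝ}

theorem ae_tendsto_iterate (hm : 0 < m) (hX : (solutionSet A B b).Nonempty)
    (hS : IsSketch μ S) (hSA : QuotientWellDefined A μ S) (hmeas : ∀ k, Measurable (Sk k))
    (hident : ∀ k, IdentDistrib (Sk k) S P μ) (hindep : iIndepFun Sk P)
    (hσβ : sigmaN (psdSqrt (sketchH A μ S) * A) = specNorm (psdSqrt (sketchH A μ S) * B))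
    (hα0 : 0 < α) (hα1 : α < 1) :
    ∀ᵐ ω ∂P, (∃ y ∈ solutionSet A B b,
        Tendsto (fun k => iterate A B b α Sk x0 k ω) atTop (𝓝 y)) ∧
      Tendsto (fun k => residual A B b (iterate A B b α Sk x0 k ω)) atTop (𝓝 0) := by
  have hH := posDef_sketchH hS hSA
  set H := sketchH A μ S with hHdef
  have hc : 0 < α * (1 - α) := mul_pos hα0 (by linarith)
  have hlam := lambdaMin_pos hm hH
  set h : EuclideanSpace ℝ (Fin n) → ℝ := fun x => α * (1 - α) *
    inner ℝ (residual A B b x) (Matrix.toEuclideanLin H (residual A B b x)) with hh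
  have hquad (x : EuclideanSpace ℝ (Fin n)) : α * (1 - α) * lambdaMin H *
      ‖residual A B b x‖ ^ 2 ≤ h x := by
    rw [mul_assoc]
    exact mul_le_mul_of_nonneg_left (lambdaMin_mul_norm_sq_le hH _) hc.le
  have hh0 (x : EuclideanSpace ℝ (Fin n)) : 0 ≤ h x := le_trans (by positivity) (hquad x)
  have hhm : Measurable h := by
    have h1 := (Matrix.toEuclideanLin H).continuous_of_finiteDimensional
    have h2 := continuous_residual (A := A) (B := B) (b := b)
    exact (continuous_const.mul (h2.inner (h1.comp h2))).measurable
  have hz (z : EuclideanSpace ℝ (Fin n)) (hz : z ∈ solutionSet A B b) :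
      ∀ᵐ ω ∂P, (∃ c, Tendsto (fun k => ‖iterate A B b α Sk x0 k ω - z‖ ^ 2) atTop (𝓝 c)) ∧
        Tendsto (fun k => h (iterate A B b α Sk x0 k ω)) atTop (𝓝 0) := by
    refine ae_tendsto_of_descent (g := fun x => ‖x - z‖ ^ 2) hmeas hident hindep
      (by fun_prop) (fun _ => sq_nonneg _) hhm hh0 fun x => ?_
    refine lintegral_norm_sketchStep_sub_sq_le hS hSA hα0.le hz (le_of_eq ?_)
    -- With σ = β the factor of ‖x - z‖² is 1, and the one-step bound is exactly `g - h`.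
    rw [hσβ]
    simp [hh, ← hHdef]
  -- The exceptional null set depends on `z`; a countable dense set of solutions leaves a single
  -- null set.
  obtain ⟨D, hDX, hDc, hcl⟩ :=
    (TopologicalSpace.IsSeparable.of_separableSpace (solutionSet A B b)).exists_countable_dense_subset
  obtain ⟨w, hw⟩ := hX
  have hall := (ae_ball_iff hDc).2 fun z hzD => hz z (hDX hzD)
  filter_upwards [hall, hz w hw] with ω h1 h2
  have hres : Tendsto (fun k => residual A B b (iterate A B b α Sk x0 k ω)) atTop (𝓝 0) := by
    have hl : 0 < α * (1 - α) * lambdaMin H := mul_pos hc hlam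
    have h3 : Tendsto (fun k => ‖residual A B b (iterate A B b α Sk x0 k ω)‖ ^ 2) atTop (𝓝 0) := by
      refine squeeze_zero (fun _ => sq_nonneg _) (fun k => ?_)
        (by simpa only [zero_div] using h2.2.div_const (α * (1 - α) * lambdaMin H))
      rw [le_div_iff₀ hl, mul_comm]
      exact hquad _
    have h4 := h3.sqrt
    simp only [Real.sqrt_sq (norm_nonneg _), Real.sqrt_zero] at h4
    exact tendsto_zero_iff_norm_tendsto_zero.2 h4
  refine ⟨exists_tendsto_of_tendsto_norm_sub ⟨w, hw⟩ hcl (fun z hzD => ?_) hres, hres⟩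
  obtain ⟨c, hc⟩ := (h1 z hzD).1
  exact ⟨√c, by simpa [Real.sqrt_sq (norm_nonneg _)] using hc.sqrt⟩

theorem eq_of_mem_solutionSet {H : Matrix (Fin m) (Fin m) ℝ}
    (hσβ : specNorm (psdSqrt H * B) < sigmaN (psdSqrt H * A)) {y z : EuclideanSpace ℝ (Fin n)}
    (hy : y ∈ solutionSet A B b) (hz : z ∈ solutionSet A B b) : y = z := by
  have h := sub_mul_norm_le_residual (H := H) (x := y) hz
  rw [residual_eq_zero_iff.2 hy, map_zero, norm_zero] at h
  have h' : ‖y - z‖ ≤ 0 := nonpos_of_mul_nonpos_right h (sub_pos.2 hσβ)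
  exact sub_eq_zero.1 (norm_le_zero_iff.1 h')

theorem integral_norm_iterate_sub_sq_le (hS : IsSketch μ S) (hSA : QuotientWellDefined A μ S)
    (hmeas : ∀ k, Measurable (Sk k)) (hident : ∀ k, IdentDistrib (Sk k) S P μ)
    (hindep : iIndepFun Sk P) {σ β : ℝ} (hσ : σ = sigmaN (psdSqrt (sketchH A μ S) * A))
    (hβ : β = specNorm (psdSqrt (sketchH A μ S) * B)) (hσβ : β < σ) {ξ : ℝ}
    (hξ : (σ + β) / σ ≤ ξ) (hξ2 : ξ < 2) (hα : α = (2 - ξ) * (σ / (σ - β)))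
    {z : EuclideanSpace ℝ (Fin n)} (hz : z ∈ solutionSet A B b) (k : ℕ) :
    Integrable (fun ω => ‖iterate A B b α Sk x0 k ω - z‖ ^ 2) P ∧
      ∫ ω, ‖iterate A B b α Sk x0 k ω - z‖ ^ 2 ∂P ≤
        (1 - (2 - ξ) * ξ * σ ^ 2) ^ k * ‖x0 - z‖ ^ 2 := by
  have hH := posDef_sketchH hS hSA
  have hβ0 : 0 ≤ β := hβ ▸ specNorm_nonneg _
  have hσ0 : 0 < σ := hβ0.trans_lt hσβ
  have hd : 0 < σ - β := sub_pos.2 hσβ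
  have hαd : α * (σ - β) = (2 - ξ) * σ := by rw [hα]; field_simp
  have hα0 : 0 ≤ α := by
    rw [hα]; exact mul_nonneg (by linarith) (div_nonneg hσ0.le hd.le)
  -- The lower bound on ξ amounts to α ≤ 1, which keeps the factor α(1 - α) nonnegative.
  have hα1 : α ≤ 1 := by
    rw [div_le_iff₀ hσ0] at hξ
    exact le_of_mul_le_mul_right (by linarith) hd
  -- The right side is α(σ² - β²) + α(1 - α)(σ - β)², the total decrease factor.
  have hρ : (2 - ξ) * ξ * σ ^ 2 = α * (σ - β) * (2 * σ - α * (σ - β)) := by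
    rw [hαd]; ring
  refine integral_iterate_le_pow_mul (g := fun x => ‖x - z‖ ^ 2) hmeas hident hindep
    (by fun_prop) (fun _ => sq_nonneg _) (fun x => ?_) k
  refine lintegral_norm_sketchStep_sub_sq_le hS hSA hα0 hz ?_
  have h1 := sub_mul_norm_le_residual (H := sketchH A μ S) (A := A) (x := x) hz
  rw [← hσ, ← hβ] at h1 ⊢
  have h2 := pow_le_pow_left₀ (mul_nonneg hd.le (norm_nonneg _)) h1 2
  rw [inner_toEuclideanLin_eq_inner_psdSqrt hH, real_inner_self_eq_norm_sq, hρ]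
  have h3 := mul_le_mul_of_nonneg_left h2 (mul_nonneg hα0 (sub_nonneg.2 hα1))
  linear_combination h3

theorem integral_infDist_iterate_sq_le (hm : 0 < m) (hX : (solutionSet A B b).Nonempty)
    (hS : IsSketch μ S) (hSA : QuotientWellDefined A μ S)
    (hmeas : ∀ k, Measurable (Sk k)) (hident : ∀ k, IdentDistrib (Sk k) S P μ)
    (hindep : iIndepFun Sk P) {σ β : ℝ} (hσ : σ = sigmaN (psdSqrt (sketchH A μ S) * A))
    (hβ : β = specNorm (psdSqrt (sketchH A μ S) * B)) {κ : ℝ} (hκ : 0 < κ)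
    (herr : ∀ x, κ * Metric.infDist x (solutionSet A B b) ≤ ‖residual A B b x‖)
    {L : ℝ} (hL : L = lambdaMin (sketchH A μ S) * κ ^ 2) (hσβ : β ^ 2 - L < σ ^ 2) {ξ : ℝ}
    (hξ : 2 * ((σ ^ 2 - β ^ 2) / (σ ^ 2 - β ^ 2 + L)) ≤ ξ) (hξ2 : ξ < 2)
    (hα : α = (2 - ξ) * ((σ ^ 2 - β ^ 2 + L) / (2 * L))) (k : ℕ) :
    Integrable (fun ω => Metric.infDist (iterate A B b α Sk x0 k ω) (solutionSet A B b) ^ 2) P ∧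
      ∫ ω, Metric.infDist (iterate A B b α Sk x0 k ω) (solutionSet A B b) ^ 2 ∂P ≤
        (1 - (2 - ξ) * ξ * ((σ ^ 2 - β ^ 2 + L) ^ 2 / (4 * L))) ^ k *
          Metric.infDist x0 (solutionSet A B b) ^ 2 := by
  have hH := posDef_sketchH hS hSA
  have hlam := lambdaMin_pos hm hH
  have hL0 : 0 < L := hL ▸ by positivity
  obtain ⟨T, hT⟩ : ∃ T, T = σ ^ 2 - β ^ 2 + L := ⟨_, rfl⟩
  have hT0 : 0 < T := by linarith
  rw [← hT] at hξ hα ⊢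
  have hαL : 2 * L * α = (2 - ξ) * T := by rw [hα]; field_simp
  have hα0 : 0 ≤ α := by
    rw [hα]; exact mul_nonneg (by linarith) (by positivity)
  have hα1 : α ≤ 1 := by
    rw [← mul_div_assoc, div_le_iff₀ hT0] at hξ
    exact le_of_mul_le_mul_left (by linarith) (mul_pos two_pos hL0)
  -- The right side is α(σ² - β²) + α(1 - α)L, where σ² - β² may be negative.
  have hρ : (2 - ξ) * ξ * (T ^ 2 / (4 * L)) = α * T - α ^ 2 * L := by
    rw [hα]; field_simp; ring
  have hdm : Continuous fun x => Metric.infDist x (solutionSet A B b) :=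
    Metric.continuous_infDist_pt _
  refine integral_iterate_le_pow_mul (g := fun x => Metric.infDist x (solutionSet A B b) ^ 2)
    hmeas hident hindep (hdm.pow 2).measurable (fun _ => sq_nonneg _) (fun x => ?_) k
  -- The step is measured against a solution nearest to the current `x`; its distance to the new
  -- point bounds the new `infDist`.
  obtain ⟨z, hz, hxz⟩ := isClosed_solutionSet.exists_infDist_eq_dist hX x
  rw [dist_eq_norm] at hxz
  have hbound : (1 - α * (σ ^ 2 - β ^ 2)) * ‖x - z‖ ^ 2 -
      α * (1 - α) * inner ℝ (residual A B b x)
        (Matrix.toEuclideanLin (sketchH A μ S) (residual A B b x)) ≤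
      (1 - (2 - ξ) * ξ * (T ^ 2 / (4 * L))) * Metric.infDist x (solutionSet A B b) ^ 2 := by
    have h1 := lambdaMin_mul_norm_sq_le hH (residual A B b x)
    have h2 := pow_le_pow_left₀ (mul_nonneg hκ.le Metric.infDist_nonneg) (herr x) 2
    have h3 := (mul_le_mul_of_nonneg_left h2 hlam.le).trans h1
    have h4 := mul_le_mul_of_nonneg_left h3 (mul_nonneg hα0 (sub_nonneg.2 hα1))
    have h5 : lambdaMin (sketchH A μ S) * (κ * Metric.infDist x (solutionSet A B b)) ^ 2 =
        L * ‖x - z‖ ^ 2 := by rw [hxz, hL]; ring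
    rw [h5] at h4
    rw [hρ, hxz, hT]
    linear_combination h4
  rw [hσ, hβ] at hbound
  obtain ⟨h6, h7⟩ := lintegral_norm_sketchStep_sub_sq_le hS hSA hα0 hz hbound
  refine ⟨h6, le_trans (lintegral_mono fun ω => ENNReal.ofReal_le_ofReal ?_) h7⟩
  refine pow_le_pow_left₀ Metric.infDist_nonneg ?_ 2
  rw [← dist_eq_norm]
  exact Metric.infDist_le_dist_of_mem hz

end Convergence

end GAVE

theorem theorem4p1 {m n q : ℕ} (hm : 0 < m) (hn : 0 < n)
    (A B : Matrix (Fin m) (Fin n) ℝ) (b : EuclideanSpace ℝ (Fin m))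
    (x0 : EuclideanSpace ℝ (Fin n))
    (hX : (GAVE.solutionSet A B b).Nonempty)
    -- the sampling space and the random sketching matrix
    {Ω : Type*} [MeasurableSpace Ω] (μ : Measure Ω) [IsProbabilityMeasure μ]
    (S : Ω → Matrix (Fin m) (Fin q) ℝ)
    (hS : GAVE.IsSketch μ S) (hSA : GAVE.QuotientWellDefined A μ S)
    -- independent draws `S_0, S_1, ...` of the sketching matrix
    {Ω' : Type*} [MeasurableSpace Ω'] (P : Measure Ω') [IsProbabilityMeasure P]
    (Sk : ℕ → Ω' → Matrix (Fin m) (Fin q) ℝ)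
    (hmeas : ∀ k, Measurable (Sk k))
    (hident : ∀ k, IdentDistrib (Sk k) S P μ)
    (hindep : iIndepFun Sk P)
    -- abbreviations
    (H : Matrix (Fin m) (Fin m) ℝ) (hH : H = GAVE.sketchH A μ S)
    (σ β : ℝ) (hσ : σ = GAVE.sigmaN (GAVE.psdSqrt H * A))
    (hβ : β = GAVE.specNorm (GAVE.psdSqrt H * B)) :
    -- (i)
    (σ = β → ∀ α : ℝ, 0 < α → α < 1 →
      (∃ φ : ℕ → ℕ, StrictMono φ ∧ ∀ᵐ ω ∂P, ∃ y ∈ GAVE.solutionSet A B b,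
        Tendsto (fun j => GAVE.iterate A B b α Sk x0 (φ j) ω) atTop (𝓝 y)) ∧
      ∀ᵐ ω ∂P, Tendsto
        (fun k => GAVE.residual A B b (GAVE.iterate A B b α Sk x0 k ω)) atTop (𝓝 0)) ∧
    -- (ii)
    (β < σ → ∀ ξ α : ℝ, (σ + β) / σ ≤ ξ → ξ < 2 → α = (2 - ξ) * (σ / (σ - β)) →
      ∀ xs ∈ GAVE.solutionSet A B b,
        (∀ y ∈ GAVE.solutionSet A B b, y = xs) ∧
        ∀ k : ℕ,
          Integrable (fun ω => ‖GAVE.iterate A B b α Sk x0 k ω - xs‖ ^ 2) P ∧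
          ∫ ω, ‖GAVE.iterate A B b α Sk x0 k ω - xs‖ ^ 2 ∂P ≤
            (1 - (2 - ξ) * ξ * σ ^ 2) ^ k * ‖x0 - xs‖ ^ 2) ∧
    -- (iii)
    (GAVE.solutionSet A B 0 = {0} →
      ∀ κ : ℝ, 0 < κ →
      (∀ x, κ * Metric.infDist x (GAVE.solutionSet A B b) ≤ ‖GAVE.residual A B b x‖) →
      ∀ lam : ℝ, lam = GAVE.lambdaMin H →
      β ^ 2 - lam * κ ^ 2 < σ ^ 2 →
      ∀ ξ α : ℝ,
        2 * ((σ ^ 2 - β ^ 2) / (σ ^ 2 - β ^ 2 + lam * κ ^ 2)) ≤ ξ → ξ < 2 →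
        α = (2 - ξ) * ((σ ^ 2 - β ^ 2 + lam * κ ^ 2) / (2 * (lam * κ ^ 2))) →
      ∀ k : ℕ,
        Integrable (fun ω =>
          Metric.infDist (GAVE.iterate A B b α Sk x0 k ω) (GAVE.solutionSet A B b) ^ 2) P ∧
        ∫ ω, Metric.infDist (GAVE.iterate A B b α Sk x0 k ω) (GAVE.solutionSet A B b) ^ 2 ∂P ≤
          (1 - (2 - ξ) * ξ *
              ((σ ^ 2 - β ^ 2 + lam * κ ^ 2) ^ 2 / (4 * (lam * κ ^ 2)))) ^ k *
            Metric.infDist x0 (GAVE.solutionSet A B b) ^ 2) := by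
  subst hH
  refine ⟨fun h α h0 h1 => ?_, fun h ξ α hξ hξ2 hα xs hxs => ⟨fun y hy => ?_, fun k => ?_⟩,
    fun _ κ hκ herr lam hlam h ξ α hξ hξ2 hα k => ?_⟩
  · have key := GAVE.ae_tendsto_iterate (x0 := x0) hm hX hS hSA hmeas hident hindep
      (hσ ▸ hβ ▸ h) h0 h1
    -- The whole sequence converges, so the subsequence can be the identity.
    exact ⟨⟨id, strictMono_id, key.mono fun ω hω => hω.1⟩, key.mono fun ω hω => hω.2⟩
  · exact GAVE.eq_of_mem_solutionSet (hσ ▸ hβ ▸ h) hy hxs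
  · exact GAVE.integral_norm_iterate_sub_sq_le hS hSA hmeas hident hindep hσ hβ h hξ hξ2 hα hxs k
  · exact GAVE.integral_infDist_iterate_sq_le hm hX hS hSA hmeas hident hindep hσ hβ hκ herr
      (by rw [hlam]) h hξ hξ2 hα k
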